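/- Let $\mathbb{H}$ be a complex separable Hilbert space. A \emph{spectral measure} on a measurable space is a map $\mathbf{E}$ from its $\sigma$-field to the (bounded, not necessarily orthogonal) projections of $\mathbb{H}$ with $\mathbf{E}(\emptyset)=0$, $\mathbf{E}(\Omega)=I$, $\mathbf{E}(\Omega\setminus A)=I-\mathbf{E}(A)$, $\mathbf{E}(A\cap B)=\mathbf{E}(A)\mathbf{E}(B)$, $\mathbf{E}(A\cup B)=\mathbf{E}(A)+\mathbf{E}(B)-\mathbf{E}(A)\mathbf{E}(B)$, that is countably additive in the strong operator topology; for a bounded measurable function $g$, the operator $\int g\,d\mathbf{E}\in\mathcal{B}(\mathbb{H})$ is the norm limit of $\int s_n\,d\mathbf{E}$ for simple functions $s_n\to g$ uniformly. A densely defined closed operator $T$ in $\mathbb{H}$ is a \emph{spectral operator of scalar type} if there is a spectral measure $\mathbf{E}$ on the Borel sets of $\mathbb{C}$ (a \emph{spectral resolution} of $T$) such that, with $T_n=\int_{\{|z|\le n\}} z\,\mathbf{E}(dz)$, the domain of $T$ is $\{x\in\mathbb{H}:\lim_n T_nx\text{ exists}\}$ and $Tx=\lim_n T_nx$ for every $x$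 in it. For Borel measurable $f:\mathbb{C}\to\mathbb{C}$, put $f_n(z)=f(z)$ if $|f(z)|\le n$ and $f_n(z)=0$ otherwise; then $f(T)$ is the operator $f(T)x=\lim_n\big(\int f_n\,d\mathbf{E}\big)x$, whose domain is the set of all $x\in\mathbb{H}$ for which this limit exists. An operator is \emph{para-Hermitian} if it is a spectral operator of scalar type with spectrum contained in $\mathbb{R}$, and \emph{para-unitary} if it is a bounded, everywhere defined spectral operator of scalar type with spectrum contained in the unit circle $\{|\lambda|=1\}$. \textbf{Proposition.} Let $H$ be a (possibly unbounded) para-Hermitian operator in $\mathbb{H}$, let $\mathbf{E}$ be a spectral resolution of $H$, and let $f(z)=e^{\mathrm{i}z}$. Then $e^{\mathrm{i}H}:=f(H)$, formed with $\mathbf{E}$, is a para-unitary operator. -/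

import Mathlib

open Filter Topology MeasureTheory

noncomputable section

/-- A spectral measure on the `σ`-field of measurable subsets of `Ω`: a map from measurable sets
into (not necessarily orthogonal) projections of `H`, multiplicative on intersections and countably
additive in the strong operator topology. The values on non-measurable sets are irrelevant. -/
structure SpectralMeasure (Ω : Type*) [MeasurableSpace Ω]
    (H : Type*) [NormedAddCommGroup H] [InnerProductSpace ℂ H] where
  /-- The projection `E(A)` attached to the set `A`. -/
  proj : Set Ω → (H →L[ℂ] H)
  isIdempotentElem_proj : ∀ A, MeasurableSet A → IsIdempotentElem (proj A)
  proj_empty : proj ∅ = 0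
  proj_univ : proj Set.univ = 1
  proj_compl : ∀ A, MeasurableSet A → proj Aᶜ = 1 - proj A
  proj_inter : ∀ A B, MeasurableSet A → MeasurableSet B → proj (A ∩ B) = proj A * proj B
  proj_union : ∀ A B, MeasurableSet A → MeasurableSet B →
    proj (A ∪ B) = proj A + proj B - proj A * proj B
  hasSum_proj_iUnion : ∀ A : ℕ → Set Ω, (∀ n, MeasurableSet (A n)) →
    Pairwise (Function.onFun Disjoint A) → ∀ x : H,
      HasSum (fun n => proj (A n) x) (proj (⋃ n, A n) x)

namespace SpectralMeasure

variable {Ω : Type*} [MeasurableSpace Ω] {H : Type*} [NormedAddCommGroup H] [InnerProductSpace ℂ H]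

/-- The integral `∑ c, c • E(s = c)` of a simple function `s`. -/
def simpleIntegral (E : SpectralMeasure Ω H) (s : SimpleFunc Ω ℂ) : H →L[ℂ] H :=
  ∑ c ∈ s.range, c • E.proj (s ⁻¹' {c})

/-- `B` is the integral of `f`: the operator-norm limit of the integrals of a sequence of simple
functions that converges to `f` uniformly. Such a sequence exists exactly when `f` is bounded and
measurable. -/
def HasIntegral (E : SpectralMeasure Ω H) (f : Ω → ℂ) (B : H →L[ℂ] H) : Prop :=
  ∃ s : ℕ → SimpleFunc Ω ℂ, TendstoUniformly (fun n ω => s n ω) f atTop ∧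
    Tendsto (fun n => E.simpleIntegral (s n)) atTop (𝓝 B)

open Classical in
/-- The integral `∫ f dE` of a bounded measurable function (junk value `0` otherwise). -/
def integral (E : SpectralMeasure Ω H) (f : Ω → ℂ) : H →L[ℂ] H :=
  if h : ∃ B, E.HasIntegral f B then h.choose else 0

/-- The truncation of `f`, equal to `f z` where `‖f z‖ ≤ n` and to `0` elsewhere. -/
def truncation (f : Ω → ℂ) (n : ℕ) : Ω → ℂ :=
  {ω | ‖f ω‖ ≤ n}.indicator f

/-- The (in general unbounded) operator `f(T)` determined by the spectral resolution `E` of `T`.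
Its domain consists of the `x` for which the limit of `(∫ fₙ dE) x` exists, where `fₙ` is the
`n`-th truncation of `f`, and its value at such an `x` is that limit. -/
def functionalCalculus (E : SpectralMeasure ℂ H) (f : ℂ → ℂ) : H →ₗ.[ℂ] H where
  domain :=
    { carrier := {x | ∃ y, Tendsto (fun n : ℕ => E.integral (truncation f n) x) atTop (𝓝 y)}
      zero_mem' := ⟨0, by simp⟩
      add_mem' := by
        rintro a b ⟨y, hy⟩ ⟨z, hz⟩
        exact ⟨y + z, by simpa using hy.add hz⟩
      smul_mem' := by
        rintro c a ⟨y, hy⟩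
        exact ⟨c • y, by simpa using hy.const_smul c⟩ }
  toFun :=
    { toFun := fun x => limUnder atTop (fun n : ℕ => E.integral (truncation f n) (x : H))
      map_add' := by
        rintro ⟨a, y, hy⟩ ⟨b, z, hz⟩
        have h := hy.add hz
        simp only [← map_add] at h
        exact h.limUnder_eq.trans (by rw [hy.limUnder_eq, hz.limUnder_eq])
      map_smul' := by
        rintro c ⟨a, y, hy⟩
        have h := hy.const_smul c
        simp only [← map_smul] at h
        exact h.limUnder_eq.trans (by rw [RingHom.id_apply, hy.limUnder_eq]) }

/-- `E` is a spectral resolution of the scalar type operator `T`: with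
`Tₙ = ∫_{|z| ≤ n} z E(dz)`, the domain of `T` is the set of the `x` for which `lim Tₙ x` exists,
and `T x = lim Tₙ x` there. -/
def IsResolutionOf (E : SpectralMeasure ℂ H) (T : H →ₗ.[ℂ] H) : Prop :=
  (∀ x : H, x ∈ T.domain ↔ ∃ y, Tendsto
    (fun n : ℕ => E.integral ((Metric.closedBall (0 : ℂ) n).indicator (fun z => z)) x)
      atTop (𝓝 y)) ∧
  ∀ x : T.domain, Tendsto
    (fun n : ℕ => E.integral ((Metric.closedBall (0 : ℂ) n).indicator (fun z => z)) (x : H))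
      atTop (𝓝 (T x))

end SpectralMeasure

section Operators

variable {H : Type*} [NormedAddCommGroup H] [InnerProductSpace ℂ H]

/-- The spectrum of an operator `T` with domain in `H`: the complement of the set of all `l` such
that `l - T` is a bijection of the domain of `T` onto `H` with a bounded inverse `R`. -/
def opSpectrum (T : H →ₗ.[ℂ] H) : Set ℂ :=
  {l | ∃ R : H →L[ℂ] H,
    (∀ y : H, ∃ x : T.domain, (x : H) = R y ∧ l • (x : H) - T x = y) ∧
    ∀ x : T.domain, R (l • (x : H) - T x) = x}ᶜ

/-- A (densely defined closed) spectral operator of scalar type. -/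
def IsScalarType (T : H →ₗ.[ℂ] H) : Prop :=
  Dense (T.domain : Set H) ∧ T.IsClosed ∧ ∃ E : SpectralMeasure ℂ H, E.IsResolutionOf T

/-- A para-Hermitian operator: a spectral operator of scalar type with real spectrum. -/
def IsParaHermitian (T : H →ₗ.[ℂ] H) : Prop :=
  IsScalarType T ∧ ∀ l ∈ opSpectrum T, l.im = 0

/-- `U` is a bounded operator, defined on all of `H`. -/
def IsBoundedOperator (U : H →ₗ.[ℂ] H) : Prop :=
  ∃ B : H →L[ℂ] H, U = (B : H →ₗ[ℂ] H).toPMap ⊤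

/-- A para-unitary operator: a bounded spectral operator of scalar type with spectrum in the unit
circle. -/
def IsParaUnitary (U : H →ₗ.[ℂ] H) : Prop :=
  IsBoundedOperator U ∧ IsScalarType U ∧ ∀ l ∈ opSpectrum U, ‖l‖ = 1

end Operators

end

/-!
Let `f z = exp (I * z)`. Two facts reduce the statement to the calculus of bounded functions.

A spectral resolution `E` of an operator `H` vanishes on the resolvent set. Let `l` be a resolvent
point, `A` a ball of radius `ε` around `l` and `R` the resolvent at `l`. The range of `P = E(A)` lies
in the domain of `H`, and `l - H` acts on it as `V = ∫_A (l - z) dE`, whose norm is `O(ε)`. Hence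
`P = R V` has norm less than one for small `ε`, and an idempotent of norm less than one is zero
(`SpectralMeasure.IsResolutionOf.exists_proj_ball_eq_zero`). Countably many such balls cover the
resolvent set, so that `E` lives on the real line when `H` is para-Hermitian
(`SpectralMeasure.IsResolutionOf.proj_eq_zero`).

On the real line `|f| = 1`. Therefore the integrals of all truncations of `f` from the first on are
equal to `U = ∫_ℝ f dE`, and `f(H) = U` is bounded and defined everywhere. The image of `E` under
`f` is a spectral resolution of `U`, by change of variables, and for `|l| ≠ 1` the resolvent of `U`
is `∫_ℝ (l - f)⁻¹ dE`, which exists because `|l - f| ≥ | |l| - 1 |` there.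

Both parts need the integral to be multiplicative and bounded for the supremum norm. The bound
`SpectralMeasure.exists_norm_simpleIntegral_le` holds because each complex measure `⟪y, E(·) x⟫` has
finite total variation: the integrals of simple functions into the unit disc are weakly bounded, and
the uniform boundedness principle applies.
-/

namespace SpectralMeasure

/-! ### Integrals of simple functions -/

section SimpleFunctions

variable {Ω : Type*} [MeasurableSpace Ω] {H : Type*} [NormedAddCommGroup H]
  [InnerProductSpace ℂ H] (E : SpectralMeasure Ω H)

theorem proj_union_of_disjoint {A B : Set Ω} (hA : MeasurableSet A) (hB : MeasurableSet B)
    (h : Disjoint A B) : E.proj (A ∪ B) = E.proj A + E.proj B := by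
  rw [E.proj_union A B hA hB, ← E.proj_inter A B hA hB, h.inter_eq, E.proj_empty, sub_zero]

/-- The values of a spectral measure, as scalar multiplication maps: this is the form in which
Mathlib's extension of additive set functions to simple functions takes them. -/
noncomputable def smulProj (A : Set Ω) : ℂ →L[ℝ] (H →L[ℂ] H) :=
  (ContinuousLinearMap.toSpanSingleton ℂ (E.proj A)).restrictScalars ℝ

@[simp]
theorem smulProj_apply (A : Set Ω) (c : ℂ) : E.smulProj A c = c • E.proj A := rfl

/-- The zero measure is chosen because it makes `FinMeasAdditive` ask for additivity on all measurable
sets, and the integrability hypotheses of Mathlib's lemmas on simple functions void. -/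
theorem finMeasAdditive_smulProj : FinMeasAdditive (0 : Measure Ω) E.smulProj := by
  intro A B hA hB _ _ h
  ext1
  simp [E.proj_union_of_disjoint hA hB h]

theorem simpleIntegral_add (s t : SimpleFunc Ω ℂ) :
    E.simpleIntegral (s + t) = E.simpleIntegral s + E.simpleIntegral t :=
  SimpleFunc.setToSimpleFunc_add _ E.finMeasAdditive_smulProj integrable_zero_measure
    integrable_zero_measure

theorem simpleIntegral_sub (s t : SimpleFunc Ω ℂ) :
    E.simpleIntegral (s - t) = E.simpleIntegral s - E.simpleIntegral t :=
  SimpleFunc.setToSimpleFunc_sub _ E.finMeasAdditive_smulProj integrable_zero_measure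
    integrable_zero_measure

theorem simpleIntegral_smul (c : ℂ) (s : SimpleFunc Ω ℂ) :
    E.simpleIntegral (c • s) = c • E.simpleIntegral s :=
  SimpleFunc.setToSimpleFunc_smul _ E.finMeasAdditive_smulProj
    (fun c A x => by simp [mul_smul]) c integrable_zero_measure

theorem simpleIntegral_indicator (c : ℂ) {A : Set Ω} (hA : MeasurableSet A) :
    E.simpleIntegral (SimpleFunc.piecewise A hA (SimpleFunc.const _ c) (SimpleFunc.const _ 0)) =
      c • E.proj A :=
  SimpleFunc.setToSimpleFunc_indicator E.smulProj (by ext; simp [E.proj_empty]) hA c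

theorem simpleIntegral_mul (s t : SimpleFunc Ω ℂ) :
    E.simpleIntegral (s * t) = E.simpleIntegral s * E.simpleIntegral t := by
  classical
  induction s using SimpleFunc.induction with
  | add _ hf hg => rw [add_mul, simpleIntegral_add, hf, hg, simpleIntegral_add, add_mul]
  | const c hA =>
    induction t using SimpleFunc.induction with
    | add _ hf hg => rw [mul_add, simpleIntegral_add, hf, hg, simpleIntegral_add, mul_add]
    | const d hB =>
      rename_i A B
      rw [simpleIntegral_indicator, simpleIntegral_indicator, smul_mul_smul_comm,
        ← E.proj_inter _ _ hA hB, ← E.simpleIntegral_indicator _ (hA.inter hB)]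
      congr 1
      ext ω
      by_cases h1 : ω ∈ A <;> by_cases h2 : ω ∈ B <;> simp [h1, h2]

/-- The spectral measure `A ↦ E(φ⁻¹(A))`. -/
def map {Ω' : Type*} [MeasurableSpace Ω'] (φ : Ω → Ω') (hφ : Measurable φ) :
    SpectralMeasure Ω' H where
  proj A := E.proj (φ ⁻¹' A)
  isIdempotentElem_proj A hA := E.isIdempotentElem_proj _ (hφ hA)
  proj_empty := E.proj_empty
  proj_univ := E.proj_univ
  proj_compl A hA := E.proj_compl _ (hφ hA)
  proj_inter A B hA hB := E.proj_inter _ _ (hφ hA) (hφ hB)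
  proj_union A B hA hB := E.proj_union _ _ (hφ hA) (hφ hB)
  hasSum_proj_iUnion A hA hd x := by
    rw [Set.preimage_iUnion]
    exact E.hasSum_proj_iUnion _ (fun n => hφ (hA n))
      (fun i j hij => (hd hij).preimage φ) x

theorem simpleIntegral_map {Ω' : Type*} [MeasurableSpace Ω'] {φ : Ω → Ω'} (hφ : Measurable φ)
    (s : SimpleFunc Ω' ℂ) :
    (E.map φ hφ).simpleIntegral s = E.simpleIntegral (s.comp φ hφ) := by
  refine (Finset.sum_subset (s.range_comp_subset_range hφ) fun c _ hc => ?_).symm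
  -- A value of `s` that `s ∘ φ` misses contributes the projection of the empty set.
  have h : φ ⁻¹' (s ⁻¹' {c}) = ∅ := by
    ext ω
    simp only [SimpleFunc.mem_range, Set.mem_range, not_exists] at hc
    simpa using hc ω
  change c • E.proj (φ ⁻¹' (s ⁻¹' {c})) = 0
  rw [h, E.proj_empty, smul_zero]

theorem proj_iUnion_eq_zero {A : ℕ → Set Ω} (hA : ∀ n, MeasurableSet (A n))
    (h : ∀ n, E.proj (A n) = 0) : E.proj (⋃ n, A n) = 0 := by
  have hd : ∀ n, MeasurableSet (disjointed A n) := fun n => MeasurableSet.disjointed hA n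
  have h0 : ∀ n, E.proj (disjointed A n) = 0 := fun n => by
    rw [← Set.inter_eq_left.mpr (disjointed_subset A n), E.proj_inter _ _ (hd n) (hA n), h, mul_zero]
  ext x
  have := E.hasSum_proj_iUnion _ hd (disjoint_disjointed A) x
  rw [iUnion_disjointed] at this
  simp only [h0] at this
  exact this.unique (by simp)

/-- The complex measure `A ↦ ⟪y, E(A) x⟫`. -/
noncomputable def scalarMeasure (x y : H) : ComplexMeasure Ω := by
  classical
  exact
  { measureOf' := fun A => if MeasurableSet A then inner ℂ y (E.proj A x) else 0
    empty' := by simp [E.proj_empty]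
    not_measurable' := fun A hA => if_neg hA
    m_iUnion' := fun A hA hd => by
      simp only [hA, MeasurableSet.iUnion hA, if_true]
      exact (E.hasSum_proj_iUnion A hA hd x).mapL (innerSL ℂ y) }

theorem scalarMeasure_apply (x y : H) {A : Set Ω} (hA : MeasurableSet A) :
    E.scalarMeasure x y A = inner ℂ y (E.proj A x) :=
  if_pos hA

/-- Complex measures have finite total variation, so the scalar measures of `E` are dominated by
finite positive measures. -/
theorem exists_measure_norm_inner_le (x y : H) : ∃ μ : Measure Ω, IsFiniteMeasure μ ∧
    ∀ A, MeasurableSet A → ‖inner ℂ y (E.proj A x)‖ ≤ μ.real A := by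
  set ν := E.scalarMeasure x y
  refine ⟨(ComplexMeasure.re ν).totalVariation + (ComplexMeasure.im ν).totalVariation,
    inferInstance, fun A hA => ?_⟩
  rw [measureReal_add_apply, ← E.scalarMeasure_apply x y hA]
  refine (Complex.norm_le_abs_re_add_abs_im _).trans (add_le_add ?_ ?_)
  · exact (ComplexMeasure.re ν).norm_le_totalVariation A
  · exact (ComplexMeasure.im ν).norm_le_totalVariation A

theorem exists_norm_inner_simpleIntegral_le (x y : H) : ∃ C, ∀ s : SimpleFunc Ω ℂ,
    (∀ ω, ‖s ω‖ ≤ 1) → ‖inner ℂ y (E.simpleIntegral s x)‖ ≤ C := by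
  obtain ⟨μ, _, hμ⟩ := E.exists_measure_norm_inner_le x y
  refine ⟨μ.real Set.univ, fun s hs => ?_⟩
  calc ‖inner ℂ y (E.simpleIntegral s x)‖
      = ‖∑ c ∈ s.range, c * inner ℂ y (E.proj (s ⁻¹' {c}) x)‖ := by
        simp [simpleIntegral, sum_apply]
    _ ≤ ∑ c ∈ s.range, μ.real (s ⁻¹' {c}) := by
        refine norm_sum_le_of_le _ fun c hc => ?_
        obtain ⟨ω, rfl⟩ := SimpleFunc.mem_range.mp hc
        rw [norm_mul]
        exact (mul_le_of_le_one_left (norm_nonneg _) (hs ω)).trans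
          (hμ _ (s.measurableSet_fiber _))
    _ = μ.real Set.univ := by
        rw [sum_measureReal_preimage_singleton _ (fun c _ => s.measurableSet_fiber c),
          SimpleFunc.coe_range, Set.preimage_range]

/-- Integration of simple functions is bounded for the supremum norm: the integrals of the simple
functions into the unit disc are weakly bounded, hence bounded, by the uniform boundedness
principle. -/
theorem exists_norm_simpleIntegral_le [CompleteSpace H] : ∃ C, 0 ≤ C ∧
    ∀ (s : SimpleFunc Ω ℂ) (b : ℝ), (∀ ω, ‖s ω‖ ≤ b) → 0 ≤ b → ‖E.simpleIntegral s‖ ≤ C * b := by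
  obtain ⟨C, hC⟩ : ∃ C, ∀ s : {s : SimpleFunc Ω ℂ // ∀ ω, ‖s ω‖ ≤ 1},
      ‖E.simpleIntegral s‖ ≤ C := by
    refine banach_steinhaus fun x => ?_
    obtain ⟨C, hC⟩ := banach_steinhaus
      (g := fun s : {s : SimpleFunc Ω ℂ // ∀ ω, ‖s ω‖ ≤ 1} =>
        innerSL ℂ (E.simpleIntegral s x)) fun y => by
      obtain ⟨C, hC⟩ := E.exists_norm_inner_simpleIntegral_le x y
      exact ⟨C, fun s => by simpa [norm_inner_symm] using hC s s.2⟩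
    exact ⟨C, fun s => by simpa using hC s⟩
  have hC1 : ∀ s : SimpleFunc Ω ℂ, (∀ ω, ‖s ω‖ ≤ 1) → ‖E.simpleIntegral s‖ ≤ C :=
    fun s hs => hC ⟨s, hs⟩
  refine ⟨C, (norm_nonneg _).trans (hC1 0 (by simp)), fun s b hs hb => ?_⟩
  rcases hb.eq_or_lt with rfl | hb
  · have : s = (0 : ℂ) • s := by
      ext ω
      simpa using hs ω
    rw [this, simpleIntegral_smul]
    simp
  · have h1 := hC1 (((b⁻¹ : ℝ) : ℂ) • s) fun ω => by
      rw [SimpleFunc.smul_apply, norm_smul, Complex.norm_real, Real.norm_of_nonneg (by positivity),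
        inv_mul_le_iff₀ hb]
      simpa using hs ω
    rw [simpleIntegral_smul, norm_smul, Complex.norm_real, Real.norm_of_nonneg (by positivity),
        inv_mul_le_iff₀ hb] at h1
    linarith

end SimpleFunctions
/-! ### Integrals of bounded functions -/

section Integral

variable {Ω : Type*} [MeasurableSpace Ω] {H : Type*} [NormedAddCommGroup H]
  [InnerProductSpace ℂ H] {E : SpectralMeasure Ω H} {f g : Ω → ℂ} {B D : H →L[ℂ] H}

/-- A bounded measurable function is uniformly close to a simple one: round its values to finitely
many points of a dense sequence, which suffices on a compact disc. -/
theorem exists_simpleFunc_norm_sub_le (hf : Measurable f) {b : ℝ} (hb : ∀ ω, ‖f ω‖ ≤ b) {ε : ℝ}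
    (hε : 0 < ε) : ∃ s : SimpleFunc Ω ℂ, ∀ ω, ‖s ω - f ω‖ ≤ ε := by
  set e := TopologicalSpace.denseSeq ℂ
  obtain ⟨t, ht⟩ := (isCompact_closedBall (0 : ℂ) b).elim_finite_subcover
    (fun k => Metric.ball (e k) ε) (fun _ => Metric.isOpen_ball) fun z _ => by
      obtain ⟨k, hk⟩ := (TopologicalSpace.denseRange_denseSeq ℂ).exists_dist_lt z hε
      exact Set.mem_iUnion.mpr ⟨k, hk⟩
  refine ⟨(SimpleFunc.nearestPt e (t.sup id)).comp f hf, fun ω => ?_⟩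
  obtain ⟨k, hk, hkω⟩ := Set.mem_iUnion₂.mp (ht (mem_closedBall_zero_iff.mpr (hb ω)))
  have h := SimpleFunc.edist_nearestPt_le e (f ω) (Finset.le_sup (f := id) hk)
  rw [edist_dist, edist_dist, ENNReal.ofReal_le_ofReal_iff dist_nonneg] at h
  rw [← dist_eq_norm]
  refine h.trans ?_
  rw [dist_comm]
  exact (Metric.mem_ball.mp hkω).le

theorem _root_.TendstoUniformly.eventually_norm_sub_le {s : ℕ → SimpleFunc Ω ℂ}
    (h : TendstoUniformly (fun n ω => s n ω) f atTop) {ε : ℝ} (hε : 0 < ε) :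
    ∀ᶠ n in atTop, ∀ ω, ‖s n ω - f ω‖ ≤ ε := by
  filter_upwards [Metric.tendstoUniformly_iff.mp h ε hε] with n hn ω
  rw [← dist_eq_norm, dist_comm]
  exact (hn ω).le

theorem HasIntegral.exists_norm_le (h : E.HasIntegral f B) : ∃ b, ∀ ω, ‖f ω‖ ≤ b := by
  obtain ⟨s, hs, -⟩ := h
  obtain ⟨n, hn⟩ := (hs.eventually_norm_sub_le one_pos).exists
  obtain ⟨b, hb⟩ := (s n).exists_forall_norm_le
  refine ⟨b + 1, fun ω => ?_⟩
  calc ‖f ω‖ = ‖s n ω - (s n ω - f ω)‖ := by rw [sub_sub_cancel]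
    _ ≤ b + 1 := (norm_sub_le _ _).trans (add_le_add (hb ω) (hn ω))

theorem HasIntegral.sub (hf : E.HasIntegral f B) (hg : E.HasIntegral g D) :
    E.HasIntegral (fun ω => f ω - g ω) (B - D) := by
  obtain ⟨s, hs, hs'⟩ := hf
  obtain ⟨t, ht, ht'⟩ := hg
  refine ⟨fun n => s n - t n, hs.sub ht, ?_⟩
  simpa only [simpleIntegral_sub] using hs'.sub ht'

theorem HasIntegral.mul (hf : E.HasIntegral f B) (hg : E.HasIntegral g D) :
    E.HasIntegral (fun ω => f ω * g ω) (B * D) := by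
  obtain ⟨b, hb⟩ := hf.exists_norm_le
  obtain ⟨d, hd⟩ := hg.exists_norm_le
  obtain ⟨s, hs, hs'⟩ := hf
  obtain ⟨t, ht, ht'⟩ := hg
  refine ⟨fun n => s n * t n, ?_, by simpa only [simpleIntegral_mul] using hs'.mul ht'⟩
  refine Metric.tendstoUniformly_iff.mpr fun ε hε => ?_
  -- `st - fg = (s - f)t + f(t - g)`, where `|t| ≤ |d| + 1` eventually.
  have hδ : 0 < ε / (2 * (|b| + |d| + 1)) := by positivity
  filter_upwards [hs.eventually_norm_sub_le hδ, ht.eventually_norm_sub_le hδ,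
    ht.eventually_norm_sub_le one_pos] with n h1 h2 h3 ω
  have ht1 : ‖t n ω‖ ≤ |d| + 1 := by
    calc ‖t n ω‖ = ‖g ω + (t n ω - g ω)‖ := by rw [add_sub_cancel]
      _ ≤ |d| + 1 := (norm_add_le _ _).trans
        (add_le_add ((hd ω).trans (le_abs_self d)) (h3 ω))
  rw [dist_comm, dist_eq_norm]
  calc ‖(s n * t n) ω - f ω * g ω‖
      = ‖(s n ω - f ω) * t n ω + f ω * (t n ω - g ω)‖ := by
        rw [SimpleFunc.mul_apply]; congr 1; ring
    _ ≤ ‖s n ω - f ω‖ * ‖t n ω‖ + ‖f ω‖ * ‖t n ω - g ω‖ := by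
        simpa only [norm_mul] using norm_add_le ((s n ω - f ω) * t n ω) (f ω * (t n ω - g ω))
    _ ≤ ε / (2 * (|b| + |d| + 1)) * (|d| + 1) + |b| * (ε / (2 * (|b| + |d| + 1))) := by
        gcongr
        · exact h1 ω
        · exact (hb ω).trans (le_abs_self b)
        · exact h2 ω
    _ = ε / 2 := by field_simp; ring
    _ < ε := half_lt_self hε

theorem hasIntegral_simpleFunc (s : SimpleFunc Ω ℂ) : E.HasIntegral s (E.simpleIntegral s) :=
  ⟨fun _ => s, Metric.tendstoUniformly_iff.mpr fun ε hε => by simp [hε], tendsto_const_nhds⟩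

theorem hasIntegral_indicator_const (c : ℂ) {A : Set Ω} (hA : MeasurableSet A) :
    E.HasIntegral (A.indicator fun _ => c) (c • E.proj A) := by
  classical
  convert! hasIntegral_simpleFunc (E := E)
    (SimpleFunc.piecewise A hA (SimpleFunc.const _ c) (SimpleFunc.const _ 0)) using 1
  exact (E.simpleIntegral_indicator c hA).symm

theorem hasIntegral_const (c : ℂ) : E.HasIntegral (fun _ => c) (c • (1 : H →L[ℂ] H)) := by
  simpa [E.proj_univ] using hasIntegral_indicator_const (E := E) c MeasurableSet.univ

theorem HasIntegral.comp {Ω' : Type*} [MeasurableSpace Ω'] {φ : Ω → Ω'} (hφ : Measurable φ)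
    {h : Ω' → ℂ} (hB : (E.map φ hφ).HasIntegral h B) : E.HasIntegral (h ∘ φ) B := by
  obtain ⟨s, hs, hs'⟩ := hB
  exact ⟨fun n => (s n).comp φ hφ, hs.comp φ, by simpa only [simpleIntegral_map] using hs'⟩

theorem exists_forall_hasIntegral_norm_le [CompleteSpace H] (E : SpectralMeasure Ω H) :
    ∃ C, 0 ≤ C ∧ ∀ (f : Ω → ℂ) (B : H →L[ℂ] H) (b : ℝ), E.HasIntegral f B → (∀ ω, ‖f ω‖ ≤ b) →
      0 ≤ b → ‖B‖ ≤ C * b := by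
  obtain ⟨C, hC0, hC⟩ := E.exists_norm_simpleIntegral_le
  refine ⟨C, hC0, fun f B b ⟨s, hs, hs'⟩ hb hb0 => ?_⟩
  -- The approximating simple functions are eventually bounded by `b + ε`, for every `ε > 0`.
  have key : ∀ ε : ℝ, 0 < ε → ‖B‖ ≤ C * (b + ε) := fun ε hε => by
    refine le_of_tendsto hs'.norm ?_
    filter_upwards [hs.eventually_norm_sub_le hε] with n hn
    refine hC (s n) (b + ε) (fun ω => ?_) (by positivity)
    calc ‖s n ω‖ = ‖f ω + (s n ω - f ω)‖ := by rw [add_sub_cancel]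
      _ ≤ b + ε := (norm_add_le _ _).trans (add_le_add (hb ω) (hn ω))
  refine ge_of_tendsto (x := 𝓝[>] (0 : ℝ)) (f := fun ε => C * (b + ε)) ?_
    (eventually_mem_nhdsWithin.mono key)
  have : Continuous fun ε : ℝ => C * (b + ε) := by fun_prop
  simpa using (this.tendsto 0).mono_left nhdsWithin_le_nhds

theorem HasIntegral.unique [CompleteSpace H] (h₁ : E.HasIntegral f B) (h₂ : E.HasIntegral f D) :
    B = D := by
  obtain ⟨C, -, hC⟩ := E.exists_forall_hasIntegral_norm_le
  have h := hC _ _ 0 (h₁.sub h₂) (by simp) le_rfl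
  rw [mul_zero, norm_le_zero_iff] at h
  exact sub_eq_zero.mp h

theorem HasIntegral.integral_eq [CompleteSpace H] (h : E.HasIntegral f B) : E.integral f = B := by
  have h' : ∃ B, E.HasIntegral f B := ⟨B, h⟩
  rw [integral, dif_pos h']
  exact h'.choose_spec.unique h

/-- Bounded measurable functions are integrable. -/
theorem hasIntegral_integral [CompleteSpace H] (E : SpectralMeasure Ω H) (hf : Measurable f)
    {b : ℝ} (hb : ∀ ω, ‖f ω‖ ≤ b) : E.HasIntegral f (E.integral f) := by
  obtain ⟨C, hC0, hC⟩ := E.exists_norm_simpleIntegral_le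
  choose s hs using fun n : ℕ => exists_simpleFunc_norm_sub_le hf hb
    (Nat.one_div_pos_of_nat (α := ℝ) (n := n))
  have hlim : Tendsto (fun n : ℕ => 1 / ((n : ℝ) + 1)) atTop (𝓝 0) :=
    tendsto_one_div_add_atTop_nhds_zero_nat
  have hunif : TendstoUniformly (fun n ω => s n ω) f atTop := by
    refine Metric.tendstoUniformly_iff.mpr fun ε hε => ?_
    filter_upwards [hlim.eventually (gt_mem_nhds hε)] with n hn ω
    rw [dist_comm, dist_eq_norm]
    exact (hs n ω).trans_lt hn
  have hcau : CauchySeq fun n => E.simpleIntegral (s n) := by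
    refine cauchySeq_of_le_tendsto_0 (fun N : ℕ => C * (1 / ((N : ℝ) + 1) + 1 / ((N : ℝ) + 1)))
      (fun n m N hn hm => ?_) (by simpa using (hlim.add hlim).const_mul C)
    rw [dist_eq_norm, ← simpleIntegral_sub]
    refine hC _ _ (fun ω => ?_) (by positivity)
    calc ‖(s n - s m) ω‖ = ‖(s n ω - f ω) - (s m ω - f ω)‖ := by
          rw [SimpleFunc.sub_apply, sub_sub_sub_cancel_right]
      _ ≤ 1 / ((n : ℝ) + 1) + 1 / ((m : ℝ) + 1) :=
          (norm_sub_le _ _).trans (add_le_add (hs n ω) (hs m ω))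
      _ ≤ _ := add_le_add (Nat.one_div_le_one_div hn) (Nat.one_div_le_one_div hm)
  obtain ⟨B, hB⟩ := cauchySeq_tendsto_of_complete hcau
  have h : E.HasIntegral f B := ⟨s, hunif, hB⟩
  rwa [h.integral_eq]

/-- Functions that agree off a null set have the same integral. -/
theorem HasIntegral.eq_of_eqOn_compl [CompleteSpace H] (hf : E.HasIntegral f B)
    (hg : E.HasIntegral g D) {N : Set Ω} (hN : MeasurableSet N) (h0 : E.proj N = 0)
    (hfg : Set.EqOn f g Nᶜ) : B = D := by
  have h1 := (hf.sub hg).mul (hasIntegral_indicator_const (E := E) 1 hN)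
  rw [h0, smul_zero, mul_zero] at h1
  -- `f - g` is its own product with the indicator of `N`.
  have h2 : (fun ω => (f ω - g ω) * N.indicator (fun _ => (1 : ℂ)) ω) = fun ω => f ω - g ω := by
    ext ω
    by_cases h : ω ∈ N
    · simp [h]
    · simp [h, hfg h]
  rw [h2] at h1
  exact sub_eq_zero.mp ((hf.sub hg).unique h1)

end Integral

/-! ### The support of a spectral resolution -/

section Support

variable {H : Type*} [NormedAddCommGroup H] [InnerProductSpace ℂ H] [CompleteSpace H]
  {E : SpectralMeasure ℂ H} {T : H →ₗ.[ℂ] H}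

theorem measurable_truncation {Ω : Type*} [MeasurableSpace Ω] {f : Ω → ℂ} (hf : Measurable f)
    (n : ℕ) : Measurable (truncation f n) :=
  hf.indicator (measurableSet_le hf.norm measurable_const)

theorem norm_truncation_le {Ω : Type*} (f : Ω → ℂ) (n : ℕ) (ω : Ω) : ‖truncation f n ω‖ ≤ n := by
  by_cases h : ω ∈ {ω | ‖f ω‖ ≤ n}
  · rw [truncation, Set.indicator_of_mem h]
    exact h
  · rw [truncation, Set.indicator_of_notMem h, norm_zero]
    exact n.cast_nonneg

theorem closedBall_indicator_eq_truncation (n : ℕ) :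
    (Metric.closedBall (0 : ℂ) n).indicator (fun z => z) = truncation (fun z => z) n := by
  rw [truncation]
  congr 1
  ext z
  simp

/-- On the range of `E(A)`, for a bounded set `A`, the operator acts as the bounded operator
`∫_A z dE`. -/
theorem IsResolutionOf.apply_proj (hE : E.IsResolutionOf T) {A : Set ℂ} (hA : MeasurableSet A)
    {N : ℕ} (hN : A ⊆ Metric.closedBall 0 N) {W : H →L[ℂ] H}
    (hW : E.HasIntegral (A.indicator fun z => z) W) (x : H) :
    ∃ h : E.proj A x ∈ T.domain, T ⟨E.proj A x, h⟩ = W x := by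
  have hlim : Tendsto (fun n : ℕ =>
      E.integral ((Metric.closedBall (0 : ℂ) n).indicator (fun z => z)) (E.proj A x))
      atTop (𝓝 (W x)) := by
    refine tendsto_const_nhds.congr' ?_
    filter_upwards [eventually_ge_atTop N] with n hn
    have h1 := (E.hasIntegral_integral (measurable_truncation measurable_id' n)
      (norm_truncation_le _ n)).mul (hasIntegral_indicator_const (E := E) 1 hA)
    rw [one_smul, ← closedBall_indicator_eq_truncation] at h1
    have h2 : (fun z : ℂ => (Metric.closedBall (0 : ℂ) n).indicator (fun z => z) z *
        A.indicator (fun _ => 1) z) = A.indicator fun z => z := by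
      ext z
      by_cases hz : z ∈ A
      · have : z ∈ Metric.closedBall (0 : ℂ) n :=
          Metric.closedBall_subset_closedBall (Nat.cast_le.mpr hn) (hN hz)
        simp only [Set.indicator_of_mem hz, Set.indicator_of_mem this, mul_one]
      · simp only [Set.indicator_of_notMem hz, mul_zero]
    rw [h2] at h1
    rw [hW.unique h1, mul_apply_eq_comp]
  have hmem : E.proj A x ∈ T.domain := (hE.1 _).mpr ⟨_, hlim⟩
  exact ⟨hmem, tendsto_nhds_unique (hE.2 ⟨_, hmem⟩) hlim⟩

/-- Near a point `l` of the resolvent set, the spectral measure vanishes: on the range of `E(A)`,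
for a small ball `A` around `l`, the operator `l - T` has small norm, yet its inverse is bounded. -/
theorem IsResolutionOf.exists_proj_ball_eq_zero (hE : E.IsResolutionOf T) {l : ℂ}
    (hl : l ∉ opSpectrum T) : ∃ ε > 0, E.proj (Metric.ball l ε) = 0 := by
  obtain ⟨R, -, hR⟩ : ∃ R : H →L[ℂ] H, (∀ y : H, ∃ x : T.domain, (x : H) = R y ∧
      l • (x : H) - T x = y) ∧ ∀ x : T.domain, R (l • (x : H) - T x) = x := by
    simpa only [opSpectrum, Set.notMem_compl_iff, Set.mem_ofPred_eq] using hl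
  obtain ⟨C, hC0, hC⟩ := E.exists_forall_hasIntegral_norm_le
  -- For this radius, `‖R‖ * ‖∫_A (l - z) dE‖ < 1`, where `A` is the ball.
  set ε : ℝ := 1 / (‖R‖ * C + 1) with hε
  have hε0 : 0 < ε := by positivity
  refine ⟨ε, hε0, ?_⟩
  set A := Metric.ball l ε with hAdef
  have hA : MeasurableSet A := measurableSet_ball
  obtain ⟨N, hN⟩ := exists_nat_ge (‖l‖ + ε)
  have hAN : A ⊆ Metric.closedBall 0 N := fun z hz => by
    rw [mem_closedBall_zero_iff]
    have h1 : ‖z - l‖ < ε := mem_ball_iff_norm.mp hz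
    have h2 : ‖z‖ ≤ ‖l‖ + ‖z - l‖ := by simpa using norm_add_le l (z - l)
    linarith
  have hW : E.HasIntegral (A.indicator fun z => z) (E.integral (A.indicator fun z => z)) := by
    refine E.hasIntegral_integral (measurable_id'.indicator hA) (b := N) fun z => ?_
    by_cases hz : z ∈ A
    · rw [Set.indicator_of_mem hz]
      exact mem_closedBall_zero_iff.mp (hAN hz)
    · simp [hz]
  set W := E.integral (A.indicator fun z => z)
  set P := E.proj A
  -- `V` is the integral of `(l - z)` over the ball.
  set V := l • P - W with hVdef
  have hV : ‖V‖ ≤ C * ε := by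
    refine hC _ _ _ ((hasIntegral_indicator_const l hA).sub hW) (fun z => ?_) hε0.le
    by_cases hz : z ∈ A
    · rw [Set.indicator_of_mem hz, Set.indicator_of_mem hz, norm_sub_rev]
      exact (mem_ball_iff_norm.mp hz).le
    · simp [hz, hε0.le]
  have hWP : W * P = W := by
    have h1 := hW.mul (hasIntegral_indicator_const (E := E) 1 hA)
    rw [one_smul] at h1
    refine h1.unique ?_
    convert! hW using 2 with z
    by_cases hz : z ∈ A <;> simp [hz]
  have hPP : P * P = P := E.isIdempotentElem_proj A hA
  have hVP : V * P = V := by rw [hVdef, sub_mul, smul_mul_assoc, hPP, hWP]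
  have hRV : R * V = P := by
    ext x
    obtain ⟨hmem, hT⟩ := hE.apply_proj hA hAN hW x
    have h := hR ⟨_, hmem⟩
    rw [hT] at h
    exact h
  -- The idempotent `P = RV` has norm less than one.
  have hlt : ‖R‖ * (C * ε) < 1 := by
    rw [hε, ← mul_assoc, mul_one_div, div_lt_one (by positivity)]
    exact lt_add_one _
  have hP : ‖P‖ < 1 := by
    rw [← hRV]
    refine (norm_mul_le _ _).trans_lt (lt_of_le_of_lt ?_ hlt)
    gcongr
  have h1 : ‖P‖ ≤ ‖P‖ * ‖P‖ := by
    conv_lhs => rw [← hPP]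
    exact norm_mul_le _ _
  refine norm_le_zero_iff.mp ?_
  nlinarith [norm_nonneg P]

/-- A spectral resolution vanishes on the resolvent set, which is covered by countably many balls on
which it vanishes. -/
theorem IsResolutionOf.proj_eq_zero (hE : E.IsResolutionOf T) {N : Set ℂ} (hNm : MeasurableSet N)
    (hN : ∀ l ∈ N, l ∉ opSpectrum T) : E.proj N = 0 := by
  rcases N.eq_empty_or_nonempty with rfl | hne
  · exact E.proj_empty
  choose! ε hε0 hε using fun l (hl : l ∈ N) => hE.exists_proj_ball_eq_zero (hN l hl)
  obtain ⟨t, htN, htc, hcov⟩ := TopologicalSpace.countable_cover_nhdsWithin (s := N)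
    (f := fun l => Metric.ball l (ε l))
    fun l hl => mem_nhdsWithin_of_mem_nhds (Metric.ball_mem_nhds l (hε0 l hl))
  have htne : t.Nonempty := by
    obtain ⟨l, hl⟩ := hne
    obtain ⟨m, hm, -⟩ := Set.mem_iUnion₂.mp (hcov hl)
    exact ⟨m, hm⟩
  obtain ⟨u, rfl⟩ := htc.exists_eq_range htne
  rw [Set.biUnion_range] at hcov
  have hU := E.proj_iUnion_eq_zero (A := fun n => Metric.ball (u n) (ε (u n)))
    (fun n => measurableSet_ball) fun n => hε _ (htN ⟨n, rfl⟩)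
  rw [← Set.inter_eq_left.mpr hcov,
    E.proj_inter _ _ hNm (MeasurableSet.iUnion fun n => measurableSet_ball), hU, mul_zero]

end Support

/-! ### Essentially bounded functions of a scalar type operator -/

section FunctionalCalculus

variable {H : Type*} [NormedAddCommGroup H] [InnerProductSpace ℂ H] [CompleteSpace H]
  {E : SpectralMeasure ℂ H} {f g : ℂ → ℂ} {U : H →L[ℂ] H} {N : Set ℂ}

theorem hasIntegral_truncation_of_eqOn (hf : Measurable f) (hU : E.HasIntegral g U)
    (hN : MeasurableSet N) (h0 : E.proj N = 0) (hfg : Set.EqOn f g Nᶜ) {b : ℝ}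
    (hb : ∀ z ∈ Nᶜ, ‖f z‖ ≤ b) {n : ℕ} (hn : b ≤ n) : E.HasIntegral (truncation f n) U := by
  have h := E.hasIntegral_integral (measurable_truncation hf n) (norm_truncation_le f n)
  have heq : Set.EqOn (truncation f n) g Nᶜ := fun z hz => by
    have hz' : z ∈ {w | ‖f w‖ ≤ n} := (hb z hz).trans hn
    rw [truncation, Set.indicator_of_mem hz', hfg hz]
  rwa [h.eq_of_eqOn_compl hU hN h0 heq] at h

/-- If `f` is `E`-essentially bounded, then `f(T)` is the bounded operator given by the integral of
a bounded representative `g` of `f`. -/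
theorem functionalCalculus_eq_toPMap (hf : Measurable f) (hU : E.HasIntegral g U)
    (hN : MeasurableSet N) (h0 : E.proj N = 0) (hfg : Set.EqOn f g Nᶜ) {b : ℝ}
    (hb : ∀ z ∈ Nᶜ, ‖f z‖ ≤ b) :
    E.functionalCalculus f = (U : H →ₗ[ℂ] H).toPMap ⊤ := by
  have hlim : ∀ x, Tendsto (fun n : ℕ => E.integral (truncation f n) x) atTop (𝓝 (U x)) := by
    intro x
    obtain ⟨n₀, hn₀⟩ := exists_nat_ge b
    refine tendsto_const_nhds.congr' ?_
    filter_upwards [eventually_ge_atTop n₀] with n hn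
    rw [(hasIntegral_truncation_of_eqOn hf hU hN h0 hfg hb
      (hn₀.trans (Nat.cast_le.mpr hn))).integral_eq]
  exact LinearPMap.ext (eq_top_iff.mpr fun x _ => ⟨_, hlim x⟩) fun x _ _ => (hlim x).limUnder_eq

/-- In the setting of `functionalCalculus_eq_toPMap`, the image of `E` under `f` is a spectral
resolution of `f(T)`. -/
theorem isResolutionOf_map (hf : Measurable f) (hU : E.HasIntegral g U)
    (hN : MeasurableSet N) (h0 : E.proj N = 0) (hfg : Set.EqOn f g Nᶜ) {b : ℝ}
    (hb : ∀ z ∈ Nᶜ, ‖f z‖ ≤ b) :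
    (E.map f hf).IsResolutionOf ((U : H →ₗ[ℂ] H).toPMap ⊤) := by
  have hlim : ∀ x, Tendsto (fun n : ℕ => (E.map f hf).integral
      ((Metric.closedBall (0 : ℂ) n).indicator (fun z => z)) x) atTop (𝓝 (U x)) := by
    intro x
    obtain ⟨n₀, hn₀⟩ := exists_nat_ge b
    refine tendsto_const_nhds.congr' ?_
    filter_upwards [eventually_ge_atTop n₀] with n hn
    have h1 := (E.map f hf).hasIntegral_integral (measurable_truncation measurable_id' n)
      (norm_truncation_le _ n)
    have h2 : E.HasIntegral (truncation f n) _ := h1.comp hf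
    rw [closedBall_indicator_eq_truncation, h2.unique (hasIntegral_truncation_of_eqOn hf hU hN h0
      hfg hb (hn₀.trans (Nat.cast_le.mpr hn)))]
  exact ⟨fun x => ⟨fun _ => ⟨_, hlim x⟩, fun _ => Submodule.mem_top⟩, fun x => hlim x⟩

/-- A point at a positive distance from the essential range of `g` is in the resolvent set of
`∫ g dE`: the resolvent is the integral of `1 / (l - g)`. -/
theorem notMem_opSpectrum_toPMap (hg : Measurable g) (hU : E.HasIntegral g U)
    (hN : MeasurableSet N) (h0 : E.proj N = 0) {l : ℂ} {δ : ℝ} (hδ : 0 < δ)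
    (hl : ∀ z ∈ Nᶜ, δ ≤ ‖l - g z‖) :
    l ∉ opSpectrum ((U : H →ₗ[ℂ] H).toPMap ⊤) := by
  set r : ℂ → ℂ := Nᶜ.indicator fun z => (l - g z)⁻¹
  have hr : E.HasIntegral r (E.integral r) := by
    refine E.hasIntegral_integral (((measurable_const.sub hg).inv).indicator hN.compl)
      (b := δ⁻¹) fun z => ?_
    by_cases hz : z ∈ Nᶜ
    · simp only [r, Set.indicator_of_mem hz, norm_inv]
      exact inv_anti₀ hδ (hl z hz)
    · simp only [r, Set.indicator_of_notMem hz, norm_zero]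
      positivity
  have hlU := (hasIntegral_const (E := E) l).sub hU
  have hinv : ∀ z ∈ Nᶜ, (l - g z) * r z = 1 := fun z hz => by
    simp only [r, Set.indicator_of_mem hz]
    exact mul_inv_cancel₀ (norm_pos_iff.mp (hδ.trans_le (hl z hz)))
  have h1 : (l • 1 - U) * E.integral r = 1 := by
    have := (hlU.mul hr).eq_of_eqOn_compl (hasIntegral_const 1) hN h0 hinv
    rwa [one_smul] at this
  have h2 : E.integral r * (l • 1 - U) = 1 := by
    have := (hr.mul hlU).eq_of_eqOn_compl (hasIntegral_const 1) hN h0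
      fun z hz => (mul_comm _ _).trans (hinv z hz)
    rwa [one_smul] at this
  rw [opSpectrum, Set.notMem_compl_iff]
  exact ⟨E.integral r, fun y => ⟨⟨E.integral r y, Submodule.mem_top⟩, rfl, DFunLike.congr_fun h1 y⟩,
    fun x => DFunLike.congr_fun h2 (x : H)⟩

end FunctionalCalculus

end SpectralMeasure

/-! ### Exponentials of para-Hermitian operators -/

section Bounded

variable {H : Type*} [NormedAddCommGroup H] [InnerProductSpace ℂ H]

theorem ContinuousLinearMap.isClosed_toPMap_top (U : H →L[ℂ] H) :
    ((U : H →ₗ[ℂ] H).toPMap ⊤).IsClosed := by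
  have : (((U : H →ₗ[ℂ] H).toPMap ⊤).graph : Set (H × H)) = {p | U p.1 = p.2} := by
    ext ⟨x, y⟩
    simp [LinearPMap.mem_graph_iff]
  rw [LinearPMap.IsClosed, this]
  exact isClosed_eq (U.continuous.comp continuous_fst) continuous_snd

end Bounded

theorem mainTheorem4 {𝓗 : Type*} [NormedAddCommGroup 𝓗] [InnerProductSpace ℂ 𝓗]
    [CompleteSpace 𝓗] [TopologicalSpace.SeparableSpace 𝓗]
    (H : 𝓗 →ₗ.[ℂ] 𝓗) (hH : IsParaHermitian H)
    (E : SpectralMeasure ℂ 𝓗) (hE : E.IsResolutionOf H) :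
    IsParaUnitary (E.functionalCalculus (fun z => Complex.exp (Complex.I * z))) := by
  set f : ℂ → ℂ := fun z => Complex.exp (Complex.I * z) with hfdef
  have hf : Measurable f := by fun_prop
  set N : Set ℂ := {z | z.im ≠ 0} with hNdef
  have hN : MeasurableSet N := (measurableSet_eq_fun Complex.measurable_im measurable_const).compl
  have h0 : E.proj N = 0 := hE.proj_eq_zero hN fun l hl hl' => hl (hH.2 l hl')
  have hb : ∀ z ∈ Nᶜ, ‖f z‖ = 1 := fun z hz => by
    have hz : z.im = 0 := not_not.mp hz
    simp [hfdef, Complex.norm_exp, hz]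
  -- Off the real line `f` is unbounded; its restriction to the real line represents it.
  have hg : Measurable (Nᶜ.indicator f) := hf.indicator hN.compl
  have hfg : Set.EqOn f (Nᶜ.indicator f) Nᶜ := fun z hz => (Set.indicator_of_mem hz f).symm
  have hU := E.hasIntegral_integral hg (b := 1) fun z => by
    by_cases hz : z ∈ Nᶜ
    · rw [Set.indicator_of_mem hz, hb z hz]
    · simp [Set.indicator_of_notMem hz]
  have hb' : ∀ z ∈ Nᶜ, ‖f z‖ ≤ 1 := fun z hz => (hb z hz).le
  set U := E.integral (Nᶜ.indicator f)
  rw [SpectralMeasure.functionalCalculus_eq_toPMap hf hU hN h0 hfg hb']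
  refine ⟨⟨U, rfl⟩, ⟨?_, U.isClosed_toPMap_top, E.map f hf,
    SpectralMeasure.isResolutionOf_map hf hU hN h0 hfg hb'⟩, fun l hl => ?_⟩
  · simp [LinearMap.toPMap]
  · by_contra hl1
    refine SpectralMeasure.notMem_opSpectrum_toPMap hg hU hN h0
      (abs_pos.mpr (sub_ne_zero.mpr hl1)) (fun z hz => ?_) hl
    rw [← hfg hz, ← hb z hz]
    exact abs_norm_sub_norm_le l (f z)
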